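/- Let $c,d$ be relatively prime integers with $0\le c\le d$, and let $\mathbb P$ be the rider with the single basic move $(c,d)$: a piece at $z\in\mathbb Z^2$ attacks $w\in\mathbb Z^2$ if $w-z$ is an integral multiple of $(c,d)$. For integers $q\ge 2$ and $n\ge 0$ let $u_{\mathbb P}(q;n)$ be the number of ways to place $q$ indistinguishable copies of $\mathbb P$ on distinct squares of the $n\times n$ board $\{1,\dots,n\}^2$ so that no piece attacks another one. Then, for every $q\ge2$, $u_{\mathbb P}(q;n)$ is a quasipolynomial function of $n$, $$u_{\mathbb P}(q;n)=\gamma_0(n)n^{2q}+\gamma_1(n)n^{2q-1}+\cdots+\gamma_{2q}(n)n^0\qquad(n\ge 0),$$ with rational coefficients $\gamma_i(n)$ that are periodic functions of $n$ (depending on $q$, $c$, $d$), and for every such expansion the smallest period of $\gamma_3$ is exactly $d$, and the periodic part of $\gamma_3$ is $$-\frac{1}{(q-2)!}\,\frac{\bar n(d-\bar n)(d-c)}{2d^2},\qquad \bar n:=n\bmod d\in\{0,1,\dots,d-1\};$$ that is, there is a constant $K$ (depending only on $q,c,d$) such that $\gamma_3(n)=K-\frac{1}{(q-2)!}\frac{\bar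 n(d-\bar n)(d-c)}{2d^2}$ for all $n$. -/

import Mathlib

/-- The `n × n` chessboard `[n]²`, as a set of integral points. -/
noncomputable def board (n : ℕ) : Finset (ℤ × ℤ) :=
  Finset.Icc (1 : ℤ) (n : ℤ) ×ˢ Finset.Icc (1 : ℤ) (n : ℤ)

/-- A rider with set `M` of basic moves, standing on `z`, attacks `w` if `w - z` is an integral
multiple of a basic move. -/
def Attacks (M : Set (ℤ × ℤ)) (z w : ℤ × ℤ) : Prop :=
  ∃ m ∈ M, ∃ k : ℤ, w - z = k • m

/-- A placement of indistinguishable pieces on distinct squares is nonattacking if no piece attacks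
another one. -/
def Nonattacking (M : Set (ℤ × ℤ)) (S : Finset (ℤ × ℤ)) : Prop :=
  ∀ z ∈ S, ∀ w ∈ S, z ≠ w → ¬ Attacks M z w

open Classical in
/-- `u_P(q;n)`: the number of nonattacking placements of `q` indistinguishable copies of the rider
with set `M` of basic moves on the `n × n` board. -/
noncomputable def numNonattacking (M : Set (ℤ × ℤ)) (q n : ℕ) : ℕ :=
  (((board n).powersetCard q).filter (fun S => Nonattacking M S)).card

/-- `γ 0, …, γ D` are the coefficients of `f` as a quasipolynomial of degree at most `D`:
each `γ i` is a periodic function of `n`, and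
`f n = γ 0 n * n ^ D + γ 1 n * n ^ (D - 1) + ⋯ + γ D n`. -/
def IsQuasipolynomialExpansion (f : ℕ → ℚ) (D : ℕ) (γ : ℕ → ℕ → ℚ) : Prop :=
  (∀ i ≤ D, ∃ p : ℕ, 0 < p ∧ Function.Periodic (γ i) p) ∧
    ∀ n : ℕ, f n = ∑ i ∈ Finset.range (D + 1), γ i n * (n : ℚ) ^ (D - i)

/-- The (smallest) period of `g` is exactly `p`. -/
def HasExactPeriod (g : ℕ → ℚ) (p : ℕ) : Prop :=
  IsLeast {r : ℕ | 0 < r ∧ Function.Periodic g r} p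

/-! Attacking means lying on a common line of direction `(c, d)`, so a nonattacking placement picks
points on distinct lines. Hence the count is the elementary symmetric function `e_q` of the chain
sizes `l_b` (`numNonattacking_eq_sum_prod`), and Newton's identities reduce it to the power sums
`p_k`.

The sum of the truncated differences `l_b - j` counts the board points that stay on the board after
`j` steps, which is `(n - jc)(n - jd)`. Abel summation turns this into a closed form for `p_k`
involving `⌊n/d⌋` (`sum_card_chain_pow`), hence a polynomial in `n` on each residue class mod `d`.

Here `p_1 = n²`, while `p_k` has degree at most `k + 1` and its residue-dependent part degree at
most `k - 1` (`natDegree_scaledChainPsum_sub_le`). Relative to the weight `2k` of `p_k` in `e_q`,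
residue dependence costs at least `k + 1` degrees, and there is none for `k = 1`. So it first
appears in corank three, solely through `p_2` in the term `-p_1^(q-2) p_2 / (2 (q-2)!)`. The linear
coefficient of `p_2` varies by `r(d-r)(d-c)/d²`, which gives the formula. This quantity vanishes
only at `r = 0` unless `d = 1`, which gives the exact period. -/

/-! ### Transversals of a finite fibration and Newton's identities -/

/-- The `q`-element subsets of `B` on which `f` is injective are counted by an elementary symmetric
polynomial in the sizes of the fibres of `f`. -/
lemma card_powersetCard_injOn {α β : Type*} [DecidableEq α] [DecidableEq β] (B : Finset α)
    (f : α → β) (q : ℕ) [DecidablePred fun S : Finset α => Set.InjOn f (S : Set α)] :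
    ((B.powersetCard q).filter (fun S : Finset α => Set.InjOn f (S : Set α))).card =
      ∑ T ∈ (B.image f).powersetCard q, ∏ b ∈ T, (B.filter (fun a => f a = b)).card := by
  rw [Finset.card_eq_sum_card_fiberwise (f := fun S => S.image f)
    (t := (B.image f).powersetCard q)]
  · refine Finset.sum_congr rfl fun T hT => ?_
    rw [Finset.mem_powersetCard] at hT
    rw [← Finset.card_pi]
    symm
    -- A section of `f` over `T` corresponds to its set of values.
    refine Finset.card_bij (fun g _ => T.attach.image fun b => g b.1 b.2) ?_ ?_ ?_
    · intro g hg
      rw [Finset.mem_pi] at hg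
      have hg' : ∀ b (hb : b ∈ T), g b hb ∈ B ∧ f (g b hb) = b := fun b hb => by
        simpa using hg b hb
      have hinj : Function.Injective fun b : T => g b.1 b.2 := fun b b' h => by
        have := congrArg f h
        simp only [(hg' _ _).2] at this
        exact Subtype.ext this
      simp only [Finset.mem_filter, Finset.mem_powersetCard]
      refine ⟨⟨⟨?_, ?_⟩, ?_⟩, ?_⟩
      · intro a ha
        simp only [Finset.mem_image, Finset.mem_attach, true_and] at ha
        obtain ⟨b, rfl⟩ := ha
        exact (hg' _ _).1
      · rw [Finset.card_image_of_injective _ hinj, Finset.card_attach, hT.2]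
      · intro a ha a' ha' h
        simp only [Finset.coe_image, Set.mem_image] at ha ha'
        obtain ⟨b, -, rfl⟩ := ha
        obtain ⟨b', -, rfl⟩ := ha'
        rw [(hg' _ _).2, (hg' _ _).2] at h
        rw [Subtype.ext h]
      · ext b
        simp only [Finset.mem_image, Finset.mem_attach, true_and]
        constructor
        · rintro ⟨_, ⟨b', rfl⟩, rfl⟩
          rw [(hg' _ _).2]
          exact b'.2
        · exact fun hb => ⟨_, ⟨⟨b, hb⟩, rfl⟩, (hg' _ _).2⟩
    · intro g hg g' hg' h
      rw [Finset.mem_pi] at hg hg'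
      funext b hb
      have h1 : g b hb ∈ T.attach.image fun b => g' b.1 b.2 := by
        rw [← h]
        exact Finset.mem_image.2 ⟨⟨b, hb⟩, Finset.mem_attach _ _, rfl⟩
      obtain ⟨b', -, hb'⟩ := Finset.mem_image.1 h1
      have h2 : f (g b hb) = b := (Finset.mem_filter.1 (hg b hb)).2
      have h3 : f (g' b'.1 b'.2) = b' := (Finset.mem_filter.1 (hg' b'.1 b'.2)).2
      rw [hb', h2] at h3
      obtain ⟨b', hb''⟩ := b'
      simp only at h3
      subst h3
      exact hb'.symm
    · intro S hS
      simp only [Finset.mem_filter, Finset.mem_powersetCard] at hS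
      obtain ⟨⟨⟨hSB, -⟩, hinj⟩, rfl⟩ := hS
      have hex : ∀ b ∈ S.image f, ∃ a ∈ S, f a = b := fun b hb => Finset.mem_image.1 hb
      choose g hgS hgf using hex
      refine ⟨g, ?_, ?_⟩
      · rw [Finset.mem_pi]
        exact fun b hb => Finset.mem_filter.2 ⟨hSB (hgS b hb), hgf b hb⟩
      · ext a
        simp only [Finset.mem_image, Finset.mem_attach, true_and]
        constructor
        · rintro ⟨b, rfl⟩
          exact hgS _ _
        · intro ha
          exact ⟨⟨f a, Finset.mem_image_of_mem f ha⟩, hinj (hgS _ _) ha (hgf _ _)⟩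
  · intro S hS
    simp only [Finset.coe_filter, Finset.mem_powersetCard, Set.mem_ofPred_eq] at hS
    exact Finset.mem_powersetCard.2 ⟨Finset.image_subset_image hS.1.1,
      by rw [Finset.card_image_of_injOn hS.2, hS.1.2]⟩

/-- Newton's identities for the elementary symmetric functions of a finite family. -/
lemma succ_mul_sum_powersetCard_prod {β R : Type*} [CommRing R] (s : Finset β) (l : β → R)
    (q : ℕ) :
    ((q : R) + 1) * ∑ T ∈ s.powersetCard (q + 1), ∏ b ∈ T, l b =
      ∑ i ∈ Finset.range (q + 1), (-1) ^ i * (∑ T ∈ s.powersetCard (q - i), ∏ b ∈ T, l b) *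
        ∑ b ∈ s, l b ^ (i + 1) := by
  classical
  have hval : (Finset.univ : Finset s).val.map (fun b : s => l b) = s.val.map l :=
    Multiset.attach_map_val' s.val l
  have hesymm : ∀ k, MvPolynomial.aeval (fun b : s => l b) (MvPolynomial.esymm s R k) =
      ∑ T ∈ s.powersetCard k, ∏ b ∈ T, l b := fun k => by
    rw [MvPolynomial.aeval_esymm_eq_multiset_esymm, hval, Finset.esymm_map_val]
  have hpsum : ∀ k, MvPolynomial.aeval (fun b : s => l b) (MvPolynomial.psum s R k) =
      ∑ b ∈ s, l b ^ k := fun k => by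
    simp only [MvPolynomial.psum, map_sum, map_pow, MvPolynomial.aeval_X]
    exact Finset.sum_coe_sort s fun b => l b ^ k
  have h := congrArg (MvPolynomial.aeval (fun b : s => l b))
    (MvPolynomial.mul_esymm_eq_sum s R (q + 1))
  simp only [map_mul, map_sum, map_pow, map_neg, map_one, map_natCast, hesymm, hpsum] at h
  rw [Nat.cast_add, Nat.cast_one] at h
  -- The filter only drops the antidiagonal term with first index `q + 1`; reflection then makes `i`
  -- index the power sum instead of the elementary symmetric polynomial.
  rw [h, Finset.sum_filter, Finset.Nat.sum_antidiagonal_eq_sum_range_succ_mk,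
    Finset.sum_range_succ, if_neg (by simp), add_zero, Finset.mul_sum, ← Finset.sum_range_reflect]
  refine Finset.sum_congr rfl fun i hi => ?_
  have hi' : i ≤ q := Nat.lt_succ_iff.1 (Finset.mem_range.1 hi)
  obtain ⟨j, rfl⟩ := Nat.exists_eq_add_of_le hi'
  have e1 : i + j + 1 - 1 - i = j := by omega
  have e2 : i + j - i = j := by omega
  have e3 : i + j + 1 - j = i + 1 := by omega
  simp only [e1, e2, e3]
  rw [if_pos (by omega)]
  have : (-1 : R) ^ (i + j + 1 + 1) * (-1) ^ j = (-1) ^ i := by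
    rw [← pow_add, show i + j + 1 + 1 + j = i + 2 * (j + 1) by ring, pow_add, pow_mul]
    simp
  rw [← this]
  ring

/-- A power as an Abel sum of truncated differences. -/
lemma sum_range_pow_sub_pow_mul_truncated (k l J : ℕ) (hk : k ≠ 0) :
    ∑ j ∈ Finset.range J, (((j : ℚ) + 1) ^ k - (j : ℚ) ^ k) *
      (((l - j : ℕ) : ℚ) - ((l - (j + 1) : ℕ) : ℚ)) = ((min l J : ℕ) : ℚ) ^ k := by
  induction J with
  | zero => simp [hk]
  | succ J ih =>
    rw [Finset.sum_range_succ, ih]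
    rcases Nat.lt_or_ge J l with h | h
    · rw [min_eq_right h.le, min_eq_right (Nat.succ_le_of_lt h),
        show l - J = l - (J + 1) + 1 by omega]
      push_cast
      ring
    · rw [min_eq_left h, min_eq_left (h.trans J.le_succ), Nat.sub_eq_zero_of_le h,
        Nat.sub_eq_zero_of_le (h.trans J.le_succ)]
      simp

/-- The Abel summation behind the power sums of the chain sizes. -/
lemma sum_range_pow_sub_pow_mul_linear (k m : ℕ) (hk : k ≠ 0) (α β : ℚ) :
    ∑ j ∈ Finset.range m, (((j : ℚ) + 1) ^ k - (j : ℚ) ^ k) * (α - (2 * j + 1) * β) =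
      (m : ℚ) ^ k * (α - (2 * m + 1) * β) + 2 * β * ∑ j ∈ Finset.Ico 1 (m + 1), (j : ℚ) ^ k := by
  induction m with
  | zero => simp [hk]
  | succ m ih =>
    rw [Finset.sum_range_succ, ih, Finset.sum_Ico_succ_top (by omega : 1 ≤ m + 1)]
    push_cast
    ring

/-! ### Chains of a one-move rider -/

/-- The label of the line in direction `(c, d)` through a point. -/
def lineLabel (c d : ℕ) (z : ℤ × ℤ) : ℤ := d * z.1 - c * z.2

/-- Equal labels give `d (x' - x) = c (y' - y)`; coprimality forces `d ∣ y' - y`, and the quotient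
is the multiplier. -/
lemma attacks_iff_lineLabel_eq {c d : ℕ} (hcop : Nat.Coprime c d) (hd : 0 < d) (z w : ℤ × ℤ) :
    Attacks {((c : ℤ), (d : ℤ))} z w ↔ lineLabel c d z = lineLabel c d w := by
  obtain ⟨x, y⟩ := z
  obtain ⟨x', y'⟩ := w
  simp only [Attacks, Set.mem_singleton_iff, exists_eq_left, lineLabel, Prod.mk_sub_mk,
    Prod.smul_mk, Prod.mk.injEq, smul_eq_mul]
  constructor
  · rintro ⟨k, h1, h2⟩
    linear_combination (-(d : ℤ)) * h1 + (c : ℤ) * h2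
  · intro h
    have h' : (d : ℤ) * (x' - x) = c * (y' - y) := by linear_combination -h
    have hdvd : (d : ℤ) ∣ y' - y :=
      (Nat.isCoprime_iff_coprime.2 hcop.symm).dvd_of_dvd_mul_left ⟨x' - x, h'.symm⟩
    obtain ⟨k, hk⟩ := hdvd
    refine ⟨k, ?_, by rw [hk, mul_comm]⟩
    have hd' : (d : ℤ) ≠ 0 := by exact_mod_cast hd.ne'
    apply mul_left_cancel₀ hd'
    rw [h', hk]
    ring

lemma nonattacking_iff_injOn_lineLabel {c d : ℕ} (hcop : Nat.Coprime c d) (hd : 0 < d)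
    (S : Finset (ℤ × ℤ)) :
    Nonattacking {((c : ℤ), (d : ℤ))} S ↔ Set.InjOn (lineLabel c d) (S : Set (ℤ × ℤ)) := by
  simp only [Nonattacking, attacks_iff_lineLabel_eq hcop hd]
  constructor
  · intro h z hz w hw hzw
    by_contra hne
    exact h z hz w hw hne hzw
  · exact fun h z hz w hw hne hzw => hne (h hz hw hzw)

/-- The part of the board on the line with label `b`. -/
noncomputable def chain (c d n : ℕ) (b : ℤ) : Finset (ℤ × ℤ) :=
  (board n).filter fun z => lineLabel c d z = b

/-- The labels of the lines that meet the board. -/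
noncomputable def boardLabels (c d n : ℕ) : Finset ℤ := (board n).image (lineLabel c d)

lemma numNonattacking_eq_sum_prod {c d : ℕ} (hcop : Nat.Coprime c d) (hd : 0 < d) (q n : ℕ) :
    numNonattacking {((c : ℤ), (d : ℤ))} q n =
      ∑ T ∈ (boardLabels c d n).powersetCard q, ∏ b ∈ T, (chain c d n b).card := by
  classical
  unfold chain boardLabels
  rw [← card_powersetCard_injOn, numNonattacking]
  refine congrArg Finset.card (Finset.ext fun S => ?_)
  simp only [Finset.mem_filter, nonattacking_iff_injOn_lineLabel hcop hd]

lemma mem_board {n : ℕ} {z : ℤ × ℤ} :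
    z ∈ board n ↔ (1 ≤ z.1 ∧ z.1 ≤ n) ∧ 1 ≤ z.2 ∧ z.2 ≤ n := by
  simp [board, Finset.mem_product]

/-- A chain is an arithmetic progression with step `(c, d)`. -/
lemma exists_chain_param {c d n : ℕ} (hcop : Nat.Coprime c d) (hd : 0 < d) {b : ℤ}
    (hb : b ∈ boardLabels c d n) :
    ∃ (z : ℤ × ℤ) (L : ℕ), ∀ t : ℤ, z + t • ((c : ℤ), (d : ℤ)) ∈ chain c d n b ↔
      0 ≤ t ∧ t ≤ L := by
  have hne : (chain c d n b).Nonempty := by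
    obtain ⟨z, hz, rfl⟩ := Finset.mem_image.1 hb
    exact ⟨z, Finset.mem_filter.2 ⟨hz, rfl⟩⟩
  have hd' : (0 : ℤ) < d := by exact_mod_cast hd
  have hc' : (0 : ℤ) ≤ c := Int.natCast_nonneg c
  -- The second coordinate strictly increases along the line because `d > 0`, so its extrema are the
  -- two ends of the chain.
  obtain ⟨z, hz, hzmin⟩ := Finset.exists_min_image _ (fun z : ℤ × ℤ => z.2) hne
  obtain ⟨w, hw, hwmax⟩ := Finset.exists_max_image _ (fun z : ℤ × ℤ => z.2) hne
  have hz' := Finset.mem_filter.1 hz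
  have hw' := Finset.mem_filter.1 hw
  obtain ⟨m, rfl, k, hk⟩ := (attacks_iff_lineLabel_eq hcop hd z w).2 (hz'.2.trans hw'.2.symm)
  have hk1 : w.1 = z.1 + k * c := by
    have := congrArg Prod.fst hk
    simp at this
    linarith
  have hk2 : w.2 = z.2 + k * d := by
    have := congrArg Prod.snd hk
    simp at this
    linarith
  have hk0 : 0 ≤ k := by
    have := hzmin w hw
    by_contra hneg
    nlinarith
  lift k to ℕ using hk0
  refine ⟨z, k, fun t => ⟨fun ht => ⟨?_, ?_⟩, fun ht => ?_⟩⟩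
  · have := hzmin _ ht
    simp at this
    by_contra hneg
    nlinarith
  · have := hwmax _ ht
    simp at this
    by_contra hneg
    nlinarith
  -- Since `c, d ≥ 0`, intermediate points have both coordinates between those of the ends.
  · have hzb := mem_board.1 hz'.1
    have hwb := mem_board.1 hw'.1
    refine Finset.mem_filter.2 ⟨mem_board.2 ?_, ?_⟩
    · simp only [Prod.fst_add, Prod.snd_add, Prod.smul_mk, smul_eq_mul]
      have h1 : 0 ≤ t * c := mul_nonneg ht.1 hc'
      have h2 : 0 ≤ t * d := mul_nonneg ht.1 hd'.le
      have h3 : t * c ≤ k * c := mul_le_mul_of_nonneg_right ht.2 hc'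
      have h4 : t * d ≤ k * d := mul_le_mul_of_nonneg_right ht.2 hd'.le
      refine ⟨⟨?_, ?_⟩, ?_, ?_⟩ <;> linarith
    · rw [← hz'.2]
      simp only [lineLabel, Prod.fst_add, Prod.snd_add, Prod.smul_mk, smul_eq_mul]
      ring

lemma exists_eq_add_smul_of_mem_chain {c d n : ℕ} (hcop : Nat.Coprime c d) (hd : 0 < d) {b : ℤ}
    {z w : ℤ × ℤ} (hz : z ∈ chain c d n b) (hw : w ∈ chain c d n b) :
    ∃ t : ℤ, w = z + t • ((c : ℤ), (d : ℤ)) := by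
  obtain ⟨m, rfl, k, hk⟩ := (attacks_iff_lineLabel_eq hcop hd z w).2
    ((Finset.mem_filter.1 hz).2.trans (Finset.mem_filter.1 hw).2.symm)
  exact ⟨k, by rw [← hk]; abel⟩

/-- The number of points of a chain that stay on the board after `j` steps. -/
lemma card_chain_filter_add_mem {c d n : ℕ} (hcop : Nat.Coprime c d) (hd : 0 < d) {b : ℤ}
    (hb : b ∈ boardLabels c d n) (j : ℕ) :
    ((chain c d n b).filter fun z => z + (j : ℤ) • ((c : ℤ), (d : ℤ)) ∈ board n).card =
      (chain c d n b).card - j := by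
  obtain ⟨z, L, h⟩ := exists_chain_param hcop hd hb
  have hd' : (d : ℤ) ≠ 0 := by exact_mod_cast hd.ne'
  have hz : z ∈ chain c d n b := by simpa using (h 0).2 ⟨le_rfl, Int.natCast_nonneg L⟩
  have key : ∀ i : ℕ,
      ((chain c d n b).filter fun w => w + (i : ℤ) • ((c : ℤ), (d : ℤ)) ∈ board n).card =
        L + 1 - i := by
    intro i
    rw [← Finset.card_range (L + 1 - i)]
    symm
    refine Finset.card_bij (fun t _ => z + (t : ℤ) • ((c : ℤ), (d : ℤ))) ?_ ?_ ?_
    · intro t ht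
      rw [Finset.mem_range] at ht
      refine Finset.mem_filter.2 ⟨(h t).2 ⟨by omega, by omega⟩, ?_⟩
      rw [add_assoc, ← add_smul]
      exact (Finset.mem_filter.1 ((h (t + i)).2 ⟨by omega, by omega⟩)).1
    · intro t _ t' _ htt
      have := congrArg Prod.snd htt
      simpa [hd.ne'] using this
    · intro w hw
      obtain ⟨hw1, hw2⟩ := Finset.mem_filter.1 hw
      obtain ⟨t, rfl⟩ := exists_eq_add_smul_of_mem_chain hcop hd hz hw1
      have ht := (h t).1 hw1
      have ht' : z + (t + (i : ℤ)) • ((c : ℤ), (d : ℤ)) ∈ chain c d n b := by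
        refine Finset.mem_filter.2 ⟨by rwa [add_smul, ← add_assoc], ?_⟩
        rw [← (Finset.mem_filter.1 hz).2]
        simp only [lineLabel, Prod.fst_add, Prod.snd_add, Prod.smul_mk, smul_eq_mul]
        ring
      have hti := (h _).1 ht'
      obtain ⟨t, rfl⟩ := Int.eq_ofNat_of_zero_le ht.1
      exact ⟨t, Finset.mem_range.2 (by omega), rfl⟩
  have hcard : (chain c d n b).card = L + 1 := by
    rw [← Nat.sub_zero (L + 1), ← key 0]
    congr 1
    refine (Finset.filter_true_of_mem fun w hw => ?_).symm
    simpa using (Finset.mem_filter.1 hw).1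
  rw [key j, hcard]

lemma card_board_filter_add_mem (c d n j : ℕ) :
    ((board n).filter fun z => z + (j : ℤ) • ((c : ℤ), (d : ℤ)) ∈ board n).card =
      (n - j * c) * (n - j * d) := by
  have : ((board n).filter fun z => z + (j : ℤ) • ((c : ℤ), (d : ℤ)) ∈ board n) =
      Finset.Icc (1 : ℤ) (n - j * c) ×ˢ Finset.Icc (1 : ℤ) (n - j * d) := by
    ext z
    have h1 : (0 : ℤ) ≤ j * c := by positivity
    have h2 : (0 : ℤ) ≤ j * d := by positivity
    simp only [Finset.mem_filter, mem_board, Finset.mem_product, Finset.mem_Icc, Prod.fst_add,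
      Prod.snd_add, Prod.smul_mk, smul_eq_mul]
    constructor
    · rintro ⟨_, ⟨_, _⟩, _, _⟩
      refine ⟨⟨?_, ?_⟩, ?_, ?_⟩ <;> linarith
    · rintro ⟨⟨_, _⟩, _, _⟩
      refine ⟨⟨⟨?_, ?_⟩, ?_, ?_⟩, ⟨?_, ?_⟩, ?_, ?_⟩ <;> linarith
  rw [this, Finset.card_product, Int.card_Icc, Int.card_Icc]
  have h : ∀ e : ℕ, ((n : ℤ) - e + 1 - 1).toNat = n - e := fun e => by omega
  rw [← Nat.cast_mul, ← Nat.cast_mul, h, h]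

/-- Double counting of the points that stay on the board after `j` steps, grouped by line. Truncated
subtraction covers large `j`. -/
lemma sum_card_chain_sub {c d : ℕ} (hcop : Nat.Coprime c d) (hd : 0 < d) (n j : ℕ) :
    ∑ b ∈ boardLabels c d n, ((chain c d n b).card - j) = (n - j * c) * (n - j * d) := by
  rw [← card_board_filter_add_mem, Finset.card_eq_sum_card_fiberwise (f := lineLabel c d)
    (t := boardLabels c d n)]
  · refine Finset.sum_congr rfl fun b hb => ?_
    rw [← card_chain_filter_add_mem hcop hd hb, chain, Finset.filter_comm]
  · intro z hz
    exact Finset.mem_image_of_mem _ (Finset.mem_filter.1 hz).1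

/-- The power sums of the chain sizes. -/
lemma sum_card_chain_pow {c d : ℕ} (hcd : c ≤ d) (hcop : Nat.Coprime c d) (hd : 0 < d)
    (n k : ℕ) (hk : k ≠ 0) :
    ∑ b ∈ boardLabels c d n, ((chain c d n b).card : ℚ) ^ k =
      2 * (c * d) * ∑ j ∈ Finset.Ico 1 (n / d + 1), (j : ℚ) ^ k +
        ((n / d : ℕ) : ℚ) ^ k * (n * (c + d) - (2 * (n / d : ℕ) + 1) * (c * d)) +
        ((((n / d : ℕ) : ℚ) + 1) ^ k - ((n / d : ℕ) : ℚ) ^ k) *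
          ((n - (n / d : ℕ) * c) * (n - (n / d : ℕ) * d)) := by
  set m := n / d with hm
  have hA : ∀ j ≤ m, ∑ b ∈ boardLabels c d n, (((chain c d n b).card - j : ℕ) : ℚ) =
      (n - j * c) * (n - j * d) := fun j hj => by
    have h1 : j * d ≤ n := (Nat.mul_le_mul_right d hj).trans (Nat.div_mul_le_self n d)
    have h2 : j * c ≤ n := (Nat.mul_le_mul_left j hcd).trans h1
    rw [← Nat.cast_sum, sum_card_chain_sub hcop hd]
    push_cast [Nat.cast_sub h1, Nat.cast_sub h2]
    ring
  -- At `j = m + 1` the factor `n - jd` truncates to zero, so no chain has more than `m + 1` points.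
  have hA' : ∑ b ∈ boardLabels c d n, ((chain c d n b).card - (m + 1)) = 0 := by
    have : n ≤ (m + 1) * d := by
      rw [mul_comm]
      exact (Nat.lt_mul_div_succ n hd).le
    rw [sum_card_chain_sub hcop hd, Nat.sub_eq_zero_of_le this, mul_zero]
  have hle : ∀ b ∈ boardLabels c d n, (chain c d n b).card ≤ m + 1 := fun b hb =>
    Nat.sub_eq_zero_iff_le.1 ((Finset.sum_eq_zero_iff.1 hA') b hb)
  have hpow : ∀ b ∈ boardLabels c d n, ((chain c d n b).card : ℚ) ^ k =
      ∑ j ∈ Finset.range (m + 1), (((j : ℚ) + 1) ^ k - (j : ℚ) ^ k) *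
        ((((chain c d n b).card - j : ℕ) : ℚ) - (((chain c d n b).card - (j + 1) : ℕ) : ℚ)) :=
    fun b hb => by rw [sum_range_pow_sub_pow_mul_truncated _ _ _ hk, min_eq_left (hle b hb)]
  rw [Finset.sum_congr rfl hpow, Finset.sum_comm]
  simp only [← Finset.mul_sum, Finset.sum_sub_distrib]
  -- The term `j = m` is split off because the untruncated product formula stops there; below it,
  -- consecutive products differ by a linear function of `j`.
  rw [Finset.sum_range_succ, hA m le_rfl, ← Nat.cast_sum (boardLabels c d n), hA']
  have hmid : ∑ j ∈ Finset.range m, (((j : ℚ) + 1) ^ k - (j : ℚ) ^ k) *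
      (∑ b ∈ boardLabels c d n, (((chain c d n b).card - j : ℕ) : ℚ) -
        ∑ b ∈ boardLabels c d n, (((chain c d n b).card - (j + 1) : ℕ) : ℚ)) =
      ∑ j ∈ Finset.range m, (((j : ℚ) + 1) ^ k - (j : ℚ) ^ k) *
        ((n * (c + d) : ℚ) - (2 * j + 1) * (c * d)) := by
    refine Finset.sum_congr rfl fun j hj => ?_
    have hj' := Finset.mem_range.1 hj
    rw [hA j hj'.le, hA (j + 1) hj']
    push_cast
    ring
  rw [hmid, sum_range_pow_sub_pow_mul_linear k m hk]
  push_cast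
  ring

/-! ### Power sums of the chain sizes as polynomials -/

open Polynomial in
/-- The polynomial whose value at `m` is `1 ^ k + ⋯ + m ^ k`. -/
noncomputable def faulhaberPoly (k : ℕ) : ℚ[X] :=
  ∑ i ∈ Finset.range (k + 1), C (bernoulli' i * (k + 1).choose i / (k + 1)) * X ^ (k + 1 - i)

section Polynomials

open Polynomial

lemma eval_faulhaberPoly (k m : ℕ) :
    (faulhaberPoly k).eval (m : ℚ) = ∑ j ∈ Finset.Ico 1 (m + 1), (j : ℚ) ^ k := by
  rw [sum_Ico_pow, faulhaberPoly, eval_finsetSum]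
  refine Finset.sum_congr rfl fun i _ => ?_
  simp only [eval_mul, eval_C, eval_pow, eval_X]
  ring

/-- The two displayed terms come from `bernoulli' 0 = 1` and `bernoulli' 1 = 1/2`. -/
lemma exists_faulhaberPoly_eq (j : ℕ) : ∃ G : ℚ[X], G.natDegree ≤ j + 1 ∧
    faulhaberPoly (j + 2) = C (1 / ((j : ℚ) + 3)) * X ^ (j + 3) + C (1 / 2) * X ^ (j + 2) + G := by
  refine ⟨∑ i ∈ Finset.range (j + 1), C (bernoulli' (i + 1 + 1) *
    (j + 2 + 1).choose (i + 1 + 1) / ((j + 2 : ℕ) + 1)) * X ^ (j + 2 + 1 - (i + 1 + 1)), ?_, ?_⟩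
  · refine natDegree_sum_le_of_forall_le _ _ fun i _ => ?_
    exact (natDegree_C_mul_X_pow_le _ _).trans (by omega)
  · have hj : (j : ℚ) + 2 + 1 ≠ 0 := by positivity
    rw [faulhaberPoly, Finset.sum_range_succ', Finset.sum_range_succ', add_assoc, add_comm]
    congr 1
    rw [add_comm]
    congr 1
    · simp [bernoulli'_zero]
      ring
    · simp only [zero_add, bernoulli'_one, Nat.choose_one_right]
      congr 2
      push_cast
      field_simp

lemma faulhaberPoly_one : faulhaberPoly 1 = C (1 / 2) * X ^ 2 + C (1 / 2) * X := by
  simp [faulhaberPoly, Finset.sum_range_succ, bernoulli'_zero, bernoulli'_one]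
  norm_num

lemma faulhaberPoly_two :
    faulhaberPoly 2 = C (1 / 3) * X ^ 3 + C (1 / 2) * X ^ 2 + C (1 / 6) * X := by
  simp [faulhaberPoly, Finset.sum_range_succ, bernoulli'_zero, bernoulli'_one, bernoulli'_two]
  norm_num [Nat.choose]

lemma exists_X_add_C_pow_eq (a : ℚ) (j : ℕ) : ∃ R : ℚ[X], R.natDegree ≤ j ∧
    (X + C a) ^ (j + 2) = X ^ (j + 2) + C (((j : ℚ) + 2) * a) * X ^ (j + 1) + R := by
  refine ⟨(X + C a) ^ (j + 2) - X ^ (j + 2) - C (((j : ℚ) + 2) * a) * X ^ (j + 1), ?_, by ring⟩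
  rw [natDegree_le_iff_coeff_eq_zero]
  intro N hN
  rw [coeff_sub, coeff_sub, coeff_X_add_C_pow, coeff_X_pow, coeff_C_mul, coeff_X_pow]
  rcases (show N = j + 1 ∨ N = j + 2 ∨ j + 2 < N by omega) with rfl | rfl | h
  · have : (j + 2).choose (j + 1) = j + 2 := Nat.choose_succ_self_right (j + 1)
    rw [this]
    simp
    ring
  · simp
  · rw [Nat.choose_eq_zero_of_lt h, if_neg (by omega), if_neg (by omega)]
    simp

/-- The `k`-th power sum of the chain sizes on a board of size `d * y` with `y - s` an integer, as
a polynomial in `y`. -/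
noncomputable def scaledChainPsum (c d s : ℚ) (k : ℕ) : ℚ[X] :=
  C (2 * (c * d)) * (faulhaberPoly k).comp (X + C (-s)) +
    (X + C (-s)) ^ k * (C (d * (d - c)) * X + C ((2 * s - 1) * (c * d))) +
    ((X + C (1 - s)) ^ k - (X + C (-s)) ^ k) * ((C (d - c) * X + C (s * c)) * C (d * s))

lemma eval_scaledChainPsum (c d s y : ℚ) (k : ℕ) :
    (scaledChainPsum c d s k).eval y = 2 * (c * d) * (faulhaberPoly k).eval (y - s) +
      (y - s) ^ k * (d * y * (c + d) - (2 * (y - s) + 1) * (c * d)) +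
      ((y - s + 1) ^ k - (y - s) ^ k) * ((d * y - (y - s) * c) * (d * y - (y - s) * d)) := by
  simp only [scaledChainPsum, eval_add, eval_sub, eval_mul, eval_pow, eval_C, eval_X, eval_comp]
  ring_nf

lemma scaledChainPsum_one (c d s : ℚ) : scaledChainPsum c d s 1 = C (d ^ 2) * X ^ 2 := by
  refine Polynomial.funext fun y => ?_
  rw [eval_scaledChainPsum, faulhaberPoly_one]
  simp only [eval_add, eval_mul, eval_pow, eval_C, eval_X]
  ring

/-- The source of the periodic part: with `s = r / d`, the linear coefficient carries the factor `s
(1 - s)`. -/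
lemma scaledChainPsum_two_sub (c d s : ℚ) :
    scaledChainPsum c d s 2 - scaledChainPsum c d 0 2 =
      C (d * (s * (1 - s) * (d - c))) * X + C ((scaledChainPsum c d s 2).eval 0) := by
  refine Polynomial.funext fun y => ?_
  simp only [eval_add, eval_sub, eval_mul, eval_C, eval_X, eval_scaledChainPsum,
    faulhaberPoly_two, eval_pow]
  ring

/-- The two leading coefficients of the power sums do not depend on the residue. -/
lemma natDegree_scaledChainPsum_sub_le (c d s : ℚ) (j : ℕ) :
    (scaledChainPsum c d s (j + 2) -
      C (2 * (c * d) / (j + 3) + d * (d - c)) * X ^ (j + 3)).natDegree ≤ j + 1 := by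
  obtain ⟨G, hG, hF⟩ := exists_faulhaberPoly_eq j
  obtain ⟨R₀, hR₀, h₀⟩ := exists_X_add_C_pow_eq (-s) (j + 1)
  obtain ⟨R₁, hR₁, h₁⟩ := exists_X_add_C_pow_eq (-s) j
  obtain ⟨R₂, hR₂, h₂⟩ := exists_X_add_C_pow_eq (1 - s) j
  have hj : (j : ℚ) + 3 ≠ 0 := by positivity
  -- All contributions to `X ^ (j + 2)` cancel: `-2cds + cd` from the Faulhaber term, `-(j+2)sd(d-c)
  -- + (2s-1)cd` from the second summand and `(j+2)sd(d-c)` from the third.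
  have key : scaledChainPsum c d s (j + 2) -
      C (2 * (c * d) / (j + 3) + d * (d - c)) * X ^ (j + 3) =
      C (2 * (c * d) / (j + 3)) * R₀ + C (c * d) * R₁ +
      C (2 * (c * d)) * G.comp (X + C (-s)) +
      C (-(j + 2) * s * (c * d) - (j + 2) * s * ((2 * s - 1) * (c * d)) +
        (j + 2) * (s * c * (d * s))) * X ^ (j + 1) +
      R₁ * (C (d * (d - c)) * X + C ((2 * s - 1) * (c * d))) +
      (R₂ - R₁) * ((C (d - c) * X + C (s * c)) * C (d * s)) := by
    have e : (C ((j : ℚ) + 3)) * C (1 / ((j : ℚ) + 3)) = 1 := by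
      rw [← C_mul, mul_one_div_cancel hj, C_1]
    rw [show j + 1 + 2 = j + 3 by ring, show j + 1 + 1 = j + 2 by ring,
      show (((j + 1 : ℕ) : ℚ) + 2) = j + 3 by push_cast; ring] at h₀
    have e2 : C (1 / 2 : ℚ) * 2 = 1 := by
      rw [← C_ofNat, ← C_mul]; norm_num
    rw [scaledChainPsum, hF, add_comp, add_comp, mul_comp, mul_comp, C_comp, C_comp, X_pow_comp,
      X_pow_comp, h₀, h₁, h₂, div_eq_mul_one_div (2 * (c * d)) ((j : ℚ) + 3)]
    generalize G.comp (X + C (-s)) = G'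
    generalize (1 / ((j : ℚ) + 3)) = t at *
    generalize (1 / 2 : ℚ) = t' at *
    simp only [map_mul, map_add, map_sub, map_neg, map_one, C_ofNat] at e ⊢
    linear_combination (-2 * C c * C d * C s * X ^ (j + 2)) * e +
      C c * C d * (X ^ (j + 2) - (C (j : ℚ) + 2) * C s * X ^ (j + 1) + R₁) * e2
  rw [key]
  have hX : (X + C (-s) : ℚ[X]).natDegree ≤ 1 := (natDegree_X_add_C _).le
  have hlin : ∀ a b : ℚ, (C a * X + C b).natDegree ≤ 1 := fun a b => natDegree_linear_le
  refine natDegree_add_le_of_degree_le (natDegree_add_le_of_degree_le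
    (natDegree_add_le_of_degree_le (natDegree_add_le_of_degree_le
    (natDegree_add_le_of_degree_le ?_ ?_) ?_) ?_) ?_) ?_
  · exact (natDegree_C_mul_le _ _).trans hR₀
  · exact (natDegree_C_mul_le _ _).trans (hR₁.trans j.le_succ)
  · refine (natDegree_C_mul_le _ _).trans (natDegree_comp_le.trans ?_)
    exact (Nat.mul_le_mul hG hX).trans (by omega)
  · exact natDegree_C_mul_X_pow_le _ _
  · exact natDegree_mul_le_of_le hR₁ (hlin _ _)
  · exact natDegree_mul_le_of_le ((natDegree_sub_le_of_le hR₂ hR₁).trans (max_self j).le)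
      ((natDegree_mul_C_le _ _).trans (hlin _ _))

/-- The `k`-th power sum of the chain sizes, as a polynomial in the size of the board within a
residue class `r` modulo `d`. -/
noncomputable def chainPsumPoly (c d r : ℚ) (k : ℕ) : ℚ[X] :=
  (scaledChainPsum c d (r / d) k).comp (C (1 / d) * X)

lemma chainPsumPoly_one {d : ℚ} (hd : d ≠ 0) (c r : ℚ) : chainPsumPoly c d r 1 = X ^ 2 := by
  rw [chainPsumPoly, scaledChainPsum_one, mul_comp, C_comp, X_pow_comp, mul_pow, ← mul_assoc,
    ← C_pow, ← C_mul]
  have : d ^ 2 * (1 / d) ^ 2 = 1 := by field_simp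
  rw [this, C_1, one_mul]

lemma natDegree_C_mul_X_le_one (a : ℚ) : (C a * X).natDegree ≤ 1 :=
  natDegree_C_mul_le _ _ |>.trans natDegree_X_le

lemma natDegree_comp_C_mul_X_le (p : ℚ[X]) (a : ℚ) :
    (p.comp (C a * X)).natDegree ≤ p.natDegree :=
  natDegree_comp_le.trans ((Nat.mul_le_mul_left _ (natDegree_C_mul_X_le_one a)).trans
    (mul_one _).le)

lemma natDegree_chainPsumPoly_le {d : ℚ} (hd : d ≠ 0) (c r : ℚ) (i : ℕ) :
    (chainPsumPoly c d r (i + 1)).natDegree ≤ i + 2 := by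
  rcases i with _ | j
  · rw [chainPsumPoly_one hd, natDegree_X_pow]
  · refine (natDegree_comp_C_mul_X_le _ _).trans ?_
    have := natDegree_add_le_of_degree_le (n := j + 3)
      ((natDegree_scaledChainPsum_sub_le c d (r / d) j).trans (by omega))
      (natDegree_C_mul_X_pow_le (2 * (c * d) / (j + 3) + d * (d - c)) (j + 3))
    rwa [sub_add_cancel] at this

lemma natDegree_chainPsumPoly_sub_le {d : ℚ} (hd : d ≠ 0) (c r : ℚ) (i : ℕ) :
    (chainPsumPoly c d r (i + 1) - chainPsumPoly c d 0 (i + 1)).natDegree ≤ i := by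
  rcases i with _ | j
  · rw [chainPsumPoly_one hd, chainPsumPoly_one hd, sub_self, natDegree_zero]
  · rw [chainPsumPoly, chainPsumPoly, ← sub_comp]
    refine (natDegree_comp_C_mul_X_le _ _).trans ?_
    have := natDegree_sub_le_of_le (natDegree_scaledChainPsum_sub_le c d (r / d) j)
      (natDegree_scaledChainPsum_sub_le c d (0 / d) j)
    rwa [sub_sub_sub_cancel_right, max_self] at this

lemma coeff_chainPsumPoly_two_sub {d : ℚ} (hd : d ≠ 0) (c r : ℚ) :
    (chainPsumPoly c d r 2 - chainPsumPoly c d 0 2).coeff 1 = r * (d - r) * (d - c) / d ^ 2 := by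
  rw [chainPsumPoly, chainPsumPoly, ← sub_comp, zero_div, scaledChainPsum_two_sub, add_comp,
    mul_comp, C_comp, C_comp, X_comp, ← mul_assoc, ← C_mul, coeff_add, coeff_C_mul_X, coeff_C]
  simp
  field_simp

lemma eval_chainPsumPoly {c d : ℕ} (hcd : c ≤ d) (hcop : Nat.Coprime c d) (hd : 0 < d)
    (n k : ℕ) (hk : k ≠ 0) :
    (chainPsumPoly c d (n % d : ℕ) k).eval (n : ℚ) =
      ∑ b ∈ boardLabels c d n, ((chain c d n b).card : ℚ) ^ k := by
  have hd' : (d : ℚ) ≠ 0 := by exact_mod_cast hd.ne'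
  have hn : (n : ℚ) = d * (n / d : ℕ) + (n % d : ℕ) := by exact_mod_cast (Nat.div_add_mod n d).symm
  have h1 : 1 / (d : ℚ) * n - (n % d : ℕ) / d = (n / d : ℕ) := by
    rw [hn]
    field_simp
    ring
  have h2 : (d : ℚ) * (1 / d * n) = n := by field_simp
  rw [chainPsumPoly, eval_comp, eval_scaledChainPsum, eval_mul, eval_C, eval_X, h1, h2,
    eval_faulhaberPoly, sum_card_chain_pow hcd hcop hd n k hk]

/-! ### Degrees and coefficients in Newton's recursion -/

/-- The polynomials determined by Newton's identities from the power sums `S i` of exponent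
`i + 1`. -/
noncomputable def newtonPoly (S : ℕ → ℚ[X]) : ℕ → ℚ[X]
  | 0 => 1
  | q + 1 => C (1 / ((q : ℚ) + 1)) *
      ∑ i : Fin (q + 1), (-1) ^ (i : ℕ) * newtonPoly S (q - i) * S i
  decreasing_by omega

lemma newtonPoly_zero (S : ℕ → ℚ[X]) : newtonPoly S 0 = 1 := by
  rw [newtonPoly]

lemma newtonPoly_succ (S : ℕ → ℚ[X]) (q : ℕ) :
    newtonPoly S (q + 1) = C (1 / ((q : ℚ) + 1)) *
      ∑ i ∈ Finset.range (q + 1), (-1) ^ i * newtonPoly S (q - i) * S i := by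
  rw [newtonPoly, Fin.sum_univ_eq_sum_range fun i => (-1) ^ i * newtonPoly S (q - i) * S i]

lemma eval_newtonPoly (S : ℕ → ℚ[X]) (x : ℚ) (p e : ℕ → ℚ) (hS : ∀ i, (S i).eval x = p i)
    (he0 : e 0 = 1) (he : ∀ q : ℕ, ((q : ℚ) + 1) * e (q + 1) =
      ∑ i ∈ Finset.range (q + 1), (-1) ^ i * e (q - i) * p i) (q : ℕ) :
    (newtonPoly S q).eval x = e q := by
  induction q using Nat.strong_induction_on with
  | _ q ih =>
    rcases q with _ | q
    · rw [newtonPoly_zero, eval_one, he0]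
    · have hq : (q : ℚ) + 1 ≠ 0 := by positivity
      rw [newtonPoly_succ, eval_mul, eval_C, eval_finsetSum, one_div_mul_eq_div,
        div_eq_iff hq, mul_comm, he]
      refine Finset.sum_congr rfl fun i hi => ?_
      rw [eval_mul, eval_mul, hS, ih _ (by omega), eval_pow, eval_neg, eval_one]

lemma natDegree_neg_one_pow_mul_le {n : ℕ} (i : ℕ) {p : ℚ[X]} (hp : p.natDegree ≤ n) :
    ((-1) ^ i * p).natDegree ≤ n := by
  rcases neg_one_pow_eq_or ℚ[X] i with h | h <;> simpa [h] using hp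

lemma coeff_neg_one_pow_mul (i n : ℕ) (p : ℚ[X]) :
    ((-1) ^ i * p).coeff n = (-1) ^ i * p.coeff n := by
  rcases Nat.even_or_odd i with h | h <;> simp [h.neg_one_pow]

/-- Give `S i` weight `2 (i + 1)`: only `S 0` attains this degree, so the leading coefficient is
divided by `q + 1` at each step. -/
lemma natDegree_newtonPoly_le_and_coeff {S : ℕ → ℚ[X]} (hS : ∀ i, (S i).natDegree ≤ i + 2)
    (hS0 : (S 0).coeff 2 = 1) (q : ℕ) :
    (newtonPoly S q).natDegree ≤ 2 * q ∧ (newtonPoly S q).coeff (2 * q) = 1 / (q.factorial : ℚ) := by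
  induction q using Nat.strong_induction_on with
  | _ q ih =>
    rcases q with _ | q
    · simp [newtonPoly_zero]
    · have hq : (q : ℚ) + 1 ≠ 0 := by positivity
      have hS' : ∀ i, (S i).natDegree ≤ 2 * (i + 1) := fun i => (hS i).trans (by omega)
      have hS'' : ∀ i, i ≠ 0 → (S i).coeff (2 * (i + 1)) = 0 := fun i hi =>
        coeff_eq_zero_of_natDegree_lt ((hS i).trans_lt (by omega))
      have hsplit : ∀ i ∈ Finset.range (q + 1), 2 * (q + 1) = 2 * (q - i) + 2 * (i + 1) :=
        fun i hi => by have := Finset.mem_range.1 hi; omega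
      rw [newtonPoly_succ]
      constructor
      · refine (natDegree_C_mul_le _ _).trans (natDegree_sum_le_of_forall_le _ _ fun i hi => ?_)
        rw [hsplit i hi, mul_assoc]
        exact natDegree_neg_one_pow_mul_le _
          (natDegree_mul_le_of_le (ih _ (by omega)).1 (hS' i))
      · rw [coeff_C_mul, finsetSum_coeff, Finset.sum_eq_single_of_mem 0 (by simp)]
        · rw [hsplit 0 (by simp), mul_assoc, coeff_neg_one_pow_mul,
            coeff_mul_add_eq_of_natDegree_le (ih _ (by omega)).1 (hS' 0), (ih _ (by omega)).2]
          simp only [zero_add, mul_one, hS0, Nat.sub_zero, Nat.factorial_succ]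
          push_cast
          field_simp
        · intro i hi hi0
          rw [hsplit i hi, mul_assoc, coeff_neg_one_pow_mul,
            coeff_mul_add_eq_of_natDegree_le (ih _ (by omega)).1 (hS' i), hS'' i hi0]
          ring

/-- The product difference splits as `(E - E₀) S + E₀ (S - S₀)`. The factor `X ^ 3` encodes a drop
of three in degree without truncated subtraction. -/
lemma X_pow_mul_newtonPoly_succ_sub (S S₀ : ℕ → ℚ[X]) (q : ℕ) :
    X ^ 3 * (newtonPoly S (q + 1) - newtonPoly S₀ (q + 1)) =
      C (1 / ((q : ℚ) + 1)) * ∑ i ∈ Finset.range (q + 1), (-1) ^ i *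
        ((X ^ 3 * (newtonPoly S (q - i) - newtonPoly S₀ (q - i))) * S i +
          newtonPoly S₀ (q - i) * (X ^ 3 * (S i - S₀ i))) := by
  rw [newtonPoly_succ, newtonPoly_succ]
  generalize newtonPoly S = E
  generalize newtonPoly S₀ = E₀
  rw [← mul_sub, ← Finset.sum_sub_distrib, mul_left_comm (X ^ 3), Finset.mul_sum]
  refine congrArg _ (Finset.sum_congr rfl fun i _ => ?_)
  ring

/-- If two families of power sums agree up to terms of corank two, then the polynomials that
Newton's identities give agree up to terms of corank three, and the first difference is governed by
the second power sums. -/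
lemma natDegree_X_pow_mul_newtonPoly_sub_le_and_coeff {S S₀ : ℕ → ℚ[X]} {x : ℚ}
    (hS : ∀ i, (S i).natDegree ≤ i + 2) (hS0 : (S 0).coeff 2 = 1)
    (hS₀ : ∀ i, (S₀ i).natDegree ≤ i + 2) (h0 : S 0 = S₀ 0)
    (hT : ∀ i, (S i - S₀ i).natDegree ≤ i) (hx : (S 1 - S₀ 1).coeff 1 = x) (q : ℕ) :
    (X ^ 3 * (newtonPoly S q - newtonPoly S₀ q)).natDegree ≤ 2 * q ∧
      (X ^ 3 * (newtonPoly S q - newtonPoly S₀ q)).coeff (2 * q) =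
        -(x * (q * (q - 1)) / (2 * q.factorial)) := by
  induction q using Nat.strong_induction_on with
  | _ q ih =>
    rcases q with _ | q
    · simp [newtonPoly_zero]
    · have hq : (q : ℚ) + 1 ≠ 0 := by positivity
      have hE₀ := natDegree_newtonPoly_le_and_coeff hS₀ (h0 ▸ hS0)
      have hS' : ∀ i, (S i).natDegree ≤ 2 * (i + 1) := fun i => (hS i).trans (by omega)
      have hS'' : ∀ i, i ≠ 0 → (S i).coeff (2 * (i + 1)) = 0 := fun i hi =>
        coeff_eq_zero_of_natDegree_lt ((hS i).trans_lt (by omega))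
      have hT3 : ∀ i, (X ^ 3 * (S i - S₀ i)).natDegree ≤ i + 3 := fun i => by
        rw [add_comm]
        exact natDegree_mul_le_of_le (natDegree_X_pow_le 3) (hT i)
      have hT' : ∀ i, (X ^ 3 * (S i - S₀ i)).natDegree ≤ 2 * (i + 1) := fun i => by
        rcases i with _ | i
        · simp [h0]
        · exact (hT3 _).trans (by omega)
      -- The difference is zero for `i = 0`, and `i + 3 < 2 (i + 1)` for `i ≥ 2`; only the second
      -- power sum reaches the weight.
      have hT'' : ∀ i, i ≠ 1 → (X ^ 3 * (S i - S₀ i)).coeff (2 * (i + 1)) = 0 := fun i hi => by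
        rcases i with _ | i
        · simp [h0]
        · exact coeff_eq_zero_of_natDegree_lt ((hT3 _).trans_lt (by omega))
      have hT1 : (X ^ 3 * (S 1 - S₀ 1)).coeff (2 * (1 + 1)) = x := by
        rw [show 2 * (1 + 1) = 1 + 3 by norm_num, coeff_X_pow_mul, hx]
      have hsplit : ∀ i ∈ Finset.range (q + 1), 2 * (q + 1) = 2 * (q - i) + 2 * (i + 1) :=
        fun i hi => by have := Finset.mem_range.1 hi; omega
      rw [X_pow_mul_newtonPoly_succ_sub]
      constructor
      · refine (natDegree_C_mul_le _ _).trans (natDegree_sum_le_of_forall_le _ _ fun i hi => ?_)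
        rw [hsplit i hi]
        exact natDegree_neg_one_pow_mul_le _ (natDegree_add_le_of_degree_le
          (natDegree_mul_le_of_le (ih _ (by omega)).1 (hS' i))
          (natDegree_mul_le_of_le (hE₀ _).1 (hT' i)))
      · have hcoeff : ∀ i ∈ Finset.range (q + 1), ((-1) ^ i *
            ((X ^ 3 * (newtonPoly S (q - i) - newtonPoly S₀ (q - i))) * S i +
              newtonPoly S₀ (q - i) * (X ^ 3 * (S i - S₀ i)))).coeff (2 * (q + 1)) =
            (-1) ^ i * (-(x * ((q - i : ℕ) * ((q - i : ℕ) - 1)) / (2 * (q - i).factorial)) *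
              (S i).coeff (2 * (i + 1)) +
              1 / ((q - i).factorial : ℚ) * (X ^ 3 * (S i - S₀ i)).coeff (2 * (i + 1))) := by
          intro i hi
          rw [coeff_neg_one_pow_mul, coeff_add, hsplit i hi,
            coeff_mul_add_eq_of_natDegree_le (ih _ (by omega)).1 (hS' i),
            coeff_mul_add_eq_of_natDegree_le (hE₀ _).1 (hT' i), (ih _ (by omega)).2, (hE₀ _).2]
        rw [coeff_C_mul, finsetSum_coeff, Finset.sum_congr rfl hcoeff]
        rcases q with _ | q
        · simp [h0]
        -- Only `i = 0`, which propagates the previous coefficient, and `i = 1`, which adds a new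
        -- contribution of `x`, survive.
        · rw [Finset.sum_range_succ', Finset.sum_range_succ', Finset.sum_eq_zero]
          · have hq' : (q : ℚ) + 1 ≠ 0 := by positivity
            rw [zero_add, hT1, hS'' 1 one_ne_zero, hT'' 0 zero_ne_one]
            simp only [zero_add, mul_one, hS0, Nat.sub_zero, Nat.factorial_succ,
              Nat.add_sub_cancel]
            push_cast at hq ⊢
            field_simp
            ring
          · intro i _
            rw [hS'' _ (by omega), hT'' _ (by omega)]
            ring

/-- For `q ≥ 2`, `q (q - 1) / q!` is `1 / (q - 2)!`; the former expression also serves `q = 0, 1` in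
the induction. -/
lemma coeff_newtonPoly_sub {S S₀ : ℕ → ℚ[X]} {x : ℚ}
    (hS : ∀ i, (S i).natDegree ≤ i + 2) (hS0 : (S 0).coeff 2 = 1)
    (hS₀ : ∀ i, (S₀ i).natDegree ≤ i + 2) (h0 : S 0 = S₀ 0)
    (hT : ∀ i, (S i - S₀ i).natDegree ≤ i) (hx : (S 1 - S₀ 1).coeff 1 = x) {q : ℕ}
    (hq : 2 ≤ q) :
    (newtonPoly S q).coeff (2 * q - 3) =
      (newtonPoly S₀ q).coeff (2 * q - 3) - x / (2 * (q - 2).factorial) := by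
  have h := (natDegree_X_pow_mul_newtonPoly_sub_le_and_coeff hS hS0 hS₀ h0 hT hx q).2
  rw [show 2 * q = 2 * q - 3 + 3 by omega, coeff_X_pow_mul, coeff_sub, sub_eq_iff_eq_add] at h
  rw [h]
  obtain ⟨q, rfl⟩ := Nat.exists_eq_add_of_le' hq
  rw [Nat.add_sub_cancel, Nat.factorial_succ, Nat.factorial_succ]
  push_cast
  field_simp
  ring

end Polynomials

/-! ### From residue classes to quasipolynomial coefficients and their period -/

section Quasipolynomials

open Polynomial

/-- The polynomial that agrees with `numNonattacking` on the residue class of `r` modulo `d`. -/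
noncomputable def placementPoly (c d q : ℕ) (r : ℚ) : ℚ[X] :=
  newtonPoly (fun i => chainPsumPoly c d r (i + 1)) q

lemma eval_placementPoly {c d : ℕ} (hcd : c ≤ d) (hcop : Nat.Coprime c d) (hd : 0 < d)
    (q n : ℕ) :
    (placementPoly c d q (n % d : ℕ)).eval (n : ℚ) =
      numNonattacking {((c : ℤ), (d : ℤ))} q n := by
  have h : (numNonattacking {((c : ℤ), (d : ℤ))} q n : ℚ) =
      ∑ T ∈ (boardLabels c d n).powersetCard q, ∏ b ∈ T, ((chain c d n b).card : ℚ) := by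
    rw [numNonattacking_eq_sum_prod hcop hd]
    push_cast
    rfl
  rw [h]
  exact eval_newtonPoly _ _ (fun i => ∑ b ∈ boardLabels c d n, ((chain c d n b).card : ℚ) ^ (i + 1))
    (fun q => ∑ T ∈ (boardLabels c d n).powersetCard q, ∏ b ∈ T, ((chain c d n b).card : ℚ))
    (fun i => eval_chainPsumPoly hcd hcop hd n (i + 1) i.succ_ne_zero) (by simp)
    (succ_mul_sum_powersetCard_prod _ _) q

lemma natDegree_placementPoly_le {d : ℕ} (hd : 0 < d) (c q : ℕ) (r : ℚ) :
    (placementPoly c d q r).natDegree ≤ 2 * q := by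
  have hd' : (d : ℚ) ≠ 0 := by exact_mod_cast hd.ne'
  exact (natDegree_newtonPoly_le_and_coeff (natDegree_chainPsumPoly_le hd' c r)
    (by rw [zero_add, chainPsumPoly_one hd', coeff_X_pow_self]) q).1

lemma coeff_placementPoly {d : ℕ} (hd : 0 < d) (c : ℕ) {q : ℕ} (hq : 2 ≤ q) (r : ℚ) :
    (placementPoly c d q r).coeff (2 * q - 3) = (placementPoly c d q 0).coeff (2 * q - 3) -
      r * (d - r) * (d - c) / d ^ 2 / (2 * (q - 2).factorial) := by
  have hd' : (d : ℚ) ≠ 0 := by exact_mod_cast hd.ne'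
  refine coeff_newtonPoly_sub (natDegree_chainPsumPoly_le hd' c r) ?_
    (natDegree_chainPsumPoly_le hd' c 0) ?_ (natDegree_chainPsumPoly_sub_le hd' c r)
    (coeff_chainPsumPoly_two_sub hd' c r) hq
  · rw [zero_add, chainPsumPoly_one hd', coeff_X_pow_self]
  · rw [zero_add, chainPsumPoly_one hd', chainPsumPoly_one hd']

/-- A function that is polynomial on residue classes is a quasipolynomial. -/
lemma isQuasipolynomialExpansion_coeff {f : ℕ → ℚ} {D d : ℕ} (hd : 0 < d) (P : ℕ → ℚ[X])
    (hP : ∀ r, (P r).natDegree ≤ D) (hf : ∀ n : ℕ, f n = (P (n % d)).eval (n : ℚ)) :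
    IsQuasipolynomialExpansion f D fun i n => (P (n % d)).coeff (D - i) := by
  refine ⟨fun i _ => ⟨d, hd, fun n => by simp⟩, fun n => ?_⟩
  rw [hf, eval_eq_sum_range' (Nat.lt_succ_of_le (hP _)), ← Finset.sum_range_reflect]
  rfl

/-- The coefficients of a quasipolynomial are determined by its polynomial values on a residue
class. -/
lemma IsQuasipolynomialExpansion.eq_coeff {f : ℕ → ℚ} {D d : ℕ} {γ : ℕ → ℕ → ℚ}
    (h : IsQuasipolynomialExpansion f D γ) (hd : 0 < d) (P : ℕ → ℚ[X])
    (hf : ∀ n : ℕ, f n = (P (n % d)).eval (n : ℚ)) {i : ℕ} (hi : i ≤ D) (n : ℕ) :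
    γ i n = (P (n % d)).coeff (D - i) := by
  obtain ⟨hper, hγ⟩ := h
  choose! p hp0 hp using hper
  -- A common multiple of `d` and all the periods: along `n + t * N` every coefficient is frozen, so
  -- two polynomials agree at infinitely many points.
  set N := d * ∏ i ∈ Finset.range (D + 1), p i with hN
  have hN0 : 0 < N := Nat.mul_pos hd (Finset.prod_pos fun i hi =>
    hp0 i (Nat.lt_succ_iff.1 (Finset.mem_range.1 hi)))
  have hperN : ∀ i ≤ D, ∀ t, γ i (n + t * N) = γ i n := fun i hi t => by
    obtain ⟨m, hm⟩ : p i ∣ t * N := Dvd.dvd.mul_left (Dvd.dvd.mul_left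
      (Finset.dvd_prod_of_mem p (Finset.mem_range.2 (Nat.lt_succ_of_le hi))) _) _
    rw [hm, mul_comm, ← smul_eq_mul, (hp i hi).nsmul m n]
  have hmod : ∀ t, (n + t * N) % d = n % d := fun t => by
    rw [hN, mul_left_comm, Nat.add_mul_mod_self_left]
  have hPeq : P (n % d) = ∑ i ∈ Finset.range (D + 1), C (γ i n) * X ^ (D - i) := by
    refine Polynomial.eq_of_infinite_eval_eq _ _ (Set.infinite_of_injective_forall_mem
      (f := fun t : ℕ => ((n + t * N : ℕ) : ℚ)) ?_ ?_)
    · intro t t' htt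
      simp only at htt
      have : n + t * N = n + t' * N := by exact_mod_cast htt
      exact Nat.eq_of_mul_eq_mul_right hN0 (Nat.add_left_cancel this)
    · intro t
      have h1 := hf (n + t * N)
      rw [hmod, hγ] at h1
      change eval _ _ = eval _ _
      rw [← h1, eval_finsetSum]
      refine Finset.sum_congr rfl fun i hi => ?_
      rw [hperN i (Nat.lt_succ_iff.1 (Finset.mem_range.1 hi)), eval_mul, eval_C, eval_pow, eval_X]
  rw [hPeq, finsetSum_coeff, Finset.sum_eq_single_of_mem i (Finset.mem_range.2 (by omega))]
  · rw [coeff_C_mul, coeff_X_pow_self, mul_one]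
  · intro j hj hji
    have := Finset.mem_range.1 hj
    rw [coeff_C_mul, coeff_X_pow, if_neg (by omega), mul_zero]

end Quasipolynomials

/-- A period `r` gives `g r = g 0`, and `x (d - x)` vanishes on residues only at `x = 0`, so `d ∣
r`. The case `d = 1` is exempt from `a ≠ 0` because `c = d = 1` is allowed. -/
lemma hasExactPeriod_of_residue_formula {g : ℕ → ℚ} {d : ℕ} (hd : 0 < d) {K a : ℚ}
    (ha : d ≠ 1 → a ≠ 0)
    (hg : ∀ n, g n = K + a * (((n % d : ℕ) : ℚ) * ((d : ℚ) - (n % d : ℕ)))) :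
    HasExactPeriod g d := by
  refine ⟨⟨hd, fun n => by rw [hg, hg, Nat.add_mod_right]⟩, fun r hr => ?_⟩
  obtain ⟨hr0, hr⟩ := hr
  by_cases hd1 : d = 1
  · rw [hd1]
    exact hr0
  have h := hr 0
  rw [hg, hg, zero_add, Nat.zero_mod, Nat.cast_zero, zero_mul, mul_zero, add_right_inj] at h
  have hlt : ((r % d : ℕ) : ℚ) < d := by exact_mod_cast Nat.mod_lt r hd
  have h0 : ((r % d : ℕ) : ℚ) = 0 := by
    rcases mul_eq_zero.1 h with h | h
    · exact absurd h (ha hd1)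
    · rcases mul_eq_zero.1 h with h | h
      · exact h
      · exact absurd h (sub_pos.2 hlt).ne'
  exact Nat.le_of_dvd hr0 (Nat.dvd_of_mod_eq_zero (by exact_mod_cast h0))

theorem propositionP (c d q : ℕ) (hcd : c ≤ d) (hcop : Nat.Coprime c d) (hq : 2 ≤ q) :
    (∃ γ : ℕ → ℕ → ℚ, IsQuasipolynomialExpansion
        (fun n => (numNonattacking {((c : ℤ), (d : ℤ))} q n : ℚ)) (2 * q) γ) ∧
    ∀ γ : ℕ → ℕ → ℚ, IsQuasipolynomialExpansion
        (fun n => (numNonattacking {((c : ℤ), (d : ℤ))} q n : ℚ)) (2 * q) γ →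
      HasExactPeriod (γ 3) d ∧
      ∃ K : ℚ, ∀ n : ℕ, γ 3 n = K +
        -(1 / ((q - 2).factorial : ℚ)) *
          (((n % d : ℕ) : ℚ) * ((d : ℚ) - ((n % d : ℕ) : ℚ)) * ((d : ℚ) - (c : ℚ))
            / (2 * (d : ℚ) ^ 2)) := by
  have hd : 0 < d := by
    rcases Nat.eq_zero_or_pos d with rfl | h
    · obtain rfl := Nat.le_zero.1 hcd
      simp at hcop
    · exact h
  have hd' : (d : ℚ) ≠ 0 := by exact_mod_cast hd.ne'
  have hfac : ((q - 2).factorial : ℚ) ≠ 0 := by exact_mod_cast (q - 2).factorial_ne_zero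
  have heval : ∀ n : ℕ, (numNonattacking {((c : ℤ), (d : ℤ))} q n : ℚ) =
      (placementPoly c d q (n % d : ℕ)).eval (n : ℚ) :=
    fun n => (eval_placementPoly hcd hcop hd q n).symm
  refine ⟨⟨_, isQuasipolynomialExpansion_coeff hd (fun r : ℕ => placementPoly c d q r)
    (fun r => natDegree_placementPoly_le hd c q r) heval⟩, fun γ hγ => ?_⟩
  have hγ3 : ∀ n, γ 3 n = (placementPoly c d q 0).coeff (2 * q - 3) +
      -(1 / ((q - 2).factorial : ℚ)) *
        (((n % d : ℕ) : ℚ) * ((d : ℚ) - ((n % d : ℕ) : ℚ)) * ((d : ℚ) - (c : ℚ))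
          / (2 * (d : ℚ) ^ 2)) := fun n => by
    rw [hγ.eq_coeff hd (fun r : ℕ => placementPoly c d q r) heval (by omega) n,
      coeff_placementPoly hd c hq]
    field_simp
    ring
  refine ⟨hasExactPeriod_of_residue_formula hd
    (K := (placementPoly c d q 0).coeff (2 * q - 3))
    (a := -(1 / ((q - 2).factorial : ℚ)) * (((d : ℚ) - c) / (2 * (d : ℚ) ^ 2))) ?_ ?_, _, hγ3⟩
  · intro hd1
    have hne : (d : ℚ) - c ≠ 0 := by
      rw [sub_ne_zero]
      intro h
      obtain rfl : d = c := by exact_mod_cast h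
      exact hd1 ((Nat.coprime_self d).1 hcop)
    exact mul_ne_zero (neg_ne_zero.2 (one_div_ne_zero hfac))
      (div_ne_zero hne (mul_ne_zero two_ne_zero (pow_ne_zero 2 hd')))
  · intro n
    rw [hγ3]
    ring
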